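/- For a prime power $q$ and integers $0\le m\le n$, let $J_q(n,m)$ be the Grassmann graph: its vertices are the $m$-dimensional subspaces of $\mathbb{F}_q^n$, and two vertices $X,Y$ are adjacent if and only if $\dim(X\cap Y)=m-1$. A graph is a core if every endomorphism of it (every map from its vertex set to itself that sends adjacent vertices to adjacent vertices) is an automorphism. Theorem. Let $n,m$ be integers with $4\le 2m\le n$ and $\gcd(m,n-m+1)>1$. Then there is a positive integer $c_{n,m}$, depending only on $n$ and $m$, such that $J_q(n,m)$ is a core for every prime power $q\ge c_{n,m}$. -/

import Mathlib

/-- A graph is a core if each of its endomorphisms is an automorphism, that is, a bijection of the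
vertex set that preserves adjacency in both directions. -/
def SimpleGraph.IsCore {V : Type*} (G : SimpleGraph V) : Prop :=
  ∀ φ : G →g G, ∃ ψ : G ≃g G, ∀ x, ψ x = φ x

/-- The Grassmann graph of the `m`-dimensional subspaces of the vector space `V` over `F`: two
subspaces are adjacent when their intersection has dimension `m - 1` (written without
subtraction). For `V = Fin n → F` with `F` of order `q` this is the graph `J_q(n, m)`. -/
def grassmannGraph (F V : Type*) [Field F] [AddCommGroup V] [Module F V] (m : ℕ) :
    SimpleGraph {X : Submodule F V // Module.finrank F X = m} where
  Adj X Y := Module.finrank F (X.1 ⊓ Y.1 : Submodule F V) + 1 = m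
  symm := ⟨fun X Y h => by rwa [inf_comm]⟩
  loopless := ⟨fun X h => by
    have h' := X.2
    rw [inf_idem] at h
    omega⟩

/-! Suppose some endomorphism is not an automorphism. By connectedness and regularity it identifies
two neighbours of some vertex. These are non-adjacent, and the linear group is transitive on such
pairs, so they can be used to fold any endomorphic image containing two vertices at distance two. A
smallest image is therefore a clique (`isCore_or_exists_range_isClique`).

Let `g` map onto a clique. For `2m ≤ n` the `m`-spaces through an `(m-1)`-space form a maximum
clique, a star, and `g` maps each star bijectively onto its range. A fibre of `g` thus meets every
star exactly once: it is a `q`-Steiner system. Counting incidences, `[m]` divides the Gaussian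
binomial `[n, m-1]` at `q`. If this held for infinitely many `q`, it would hold for polynomials, but
a primitive root of unity of order `gcd(m, n-m+1)` has too small a multiplicity on the right
(`not_prod_X_pow_sub_one_dvd`). -/

namespace SimpleGraph

/-! ### Endomorphisms of finite graphs: core or image a clique. -/

variable {V : Type*} {G : SimpleGraph V}

/-- In a preconnected graph, a set containing a vertex and closed under neighbours is everything. -/
theorem Preconnected.mem_of_closed (hG : G.Preconnected) {s : Set V} {a : V} (ha : a ∈ s)
    (hs : ∀ x ∈ s, ∀ y, G.Adj x y → y ∈ s) (b : V) : b ∈ s := by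
  obtain ⟨w⟩ := hG a b
  induction w with
  | nil => exact ha
  | cons h _ ih => exact ih (hs _ ha _ h)

/-- An endomorphism of a finite connected regular graph is an automorphism as soon as it is
injective on the neighbourhood of each vertex. -/
theorem exists_iso_of_locally_injective [Finite V] (hG : G.Preconnected)
    (hreg : ∀ a b, (G.neighborSet a).ncard = (G.neighborSet b).ncard) (f : G →g G)
    (hf : ∀ a, Set.InjOn f (G.neighborSet a)) : ∃ ψ : G ≃g G, ∀ x, ψ x = f x := by
  have himage : ∀ a, f '' G.neighborSet a = G.neighborSet (f a) := by
    intro a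
    refine Set.eq_of_subset_of_ncard_le ?_ ?_ (Set.toFinite _)
    · rintro _ ⟨b, hb, rfl⟩
      exact f.map_adj hb
    · rw [(hf a).ncard_image, hreg a (f a)]
  have hsurj : Function.Surjective f := by
    intro b
    refine hG.mem_of_closed (s := Set.range f) (Set.mem_range_self b) ?_ b
    rintro _ ⟨x, rfl⟩ y hy
    have hy' : y ∈ f '' G.neighborSet x := by rw [himage]; exact hy
    obtain ⟨z, -, rfl⟩ := hy'
    exact Set.mem_range_self z
  have hbij : Function.Bijective f := ⟨Finite.injective_iff_surjective.mpr hsurj, hsurj⟩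
  refine ⟨⟨Equiv.ofBijective f hbij, ?_⟩, fun x => rfl⟩
  intro a b
  refine ⟨fun h => ?_, fun h => f.map_adj h⟩
  have hb : f b ∈ f '' G.neighborSet a := by rw [himage]; exact h
  obtain ⟨c, hc, hcb⟩ := hb
  rwa [← hbij.1 hcb]

/-- A finite connected regular graph whose automorphism group is transitive on the pairs of
vertices at distance two is a core, unless some endomorphism maps it onto a clique. -/
theorem isCore_or_exists_range_isClique [Finite V] (hG : G.Preconnected)
    (hreg : ∀ a b, (G.neighborSet a).ncard = (G.neighborSet b).ncard)
    (htrans : ∀ a b c a' b' c', G.Adj a b → G.Adj b c → a ≠ c → ¬ G.Adj a c →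
      G.Adj a' b' → G.Adj b' c' → a' ≠ c' → ¬ G.Adj a' c' → ∃ ψ : G ≃g G, ψ a = a' ∧ ψ c = c') :
    G.IsCore ∨ ∃ g : G →g G, G.IsClique (Set.range g) := by
  classical
  refine or_iff_not_imp_left.mpr fun hcore => ?_
  obtain ⟨f, hf⟩ : ∃ f : G →g G, ¬ ∃ ψ : G ≃g G, ∀ x, ψ x = f x := by
    simpa only [IsCore, not_forall] using hcore
  obtain ⟨b, a, c, hab, hcb, hfac, hac⟩ :
      ∃ b a c, G.Adj b a ∧ G.Adj b c ∧ f a = f c ∧ a ≠ c := by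
    by_contra! h
    exact hf (exists_iso_of_locally_injective hG hreg f fun b x hx y hy hxy => h b x y hx hy hxy)
  have hnadj : ¬ G.Adj a c := fun h => (hfac ▸ f.map_adj h).ne rfl
  -- An endomorphism with the fewest image vertices.
  obtain ⟨g, hg⟩ : ∃ g : G →g G, ∀ h : G →g G, (Set.range g).ncard ≤ (Set.range h).ncard := by
    have hne : (Set.range fun g : G →g G => (Set.range g).ncard).Nonempty := ⟨_, ⟨f, rfl⟩⟩
    obtain ⟨g, hg⟩ := Nat.sInf_mem hne
    exact ⟨g, fun h => hg.le.trans (Nat.sInf_le ⟨h, rfl⟩)⟩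
  -- Otherwise an automorphism `ψ` carries `g x`, `g z` to the pair `a`, `c` identified by `f`, and
  -- `f ∘ ψ ∘ g` has a smaller image.
  have hstep : ∀ x y z, G.Adj (g x) (g y) → G.Adj (g y) (g z) → g x ≠ g z →
      G.Adj (g x) (g z) := by
    intro x y z hxy hyz hxz
    by_contra hnot
    obtain ⟨ψ, hψx, hψz⟩ := htrans _ _ _ _ _ _ hxy hyz hxz hnot hab.symm hcb hac hnadj
    refine (hg ((f.comp ψ.toHom).comp g)).not_gt ?_
    have hrange : Set.range ((f.comp ψ.toHom).comp g) = (fun v => f (ψ v)) '' Set.range g := by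
      ext v
      simp
    rw [hrange]
    refine lt_of_le_of_ne (Set.ncard_image_le (Set.toFinite _)) fun heq => hxz ?_
    exact (Set.ncard_image_iff (Set.toFinite _)).mp heq ⟨x, rfl⟩ ⟨z, rfl⟩
      (by simp only [hψx, hψz, hfac])
  refine ⟨g, ?_⟩
  rintro _ ⟨x, rfl⟩ _ ⟨y, rfl⟩ hxy
  have key : y ∈ {y | g x = g y ∨ G.Adj (g x) (g y)} := by
    refine hG.mem_of_closed (a := x) (Or.inl rfl) ?_ y
    intro u hu v huv
    have huv' := g.map_adj huv
    by_cases hxv : g x = g v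
    · exact Or.inl hxv
    · rcases hu with hu | hu
      · exact Or.inr (hu ▸ huv')
      · exact Or.inr (hstep x u v hu huv' hxv)
  exact key.resolve_left hxy

end SimpleGraph

/-! ### Divisibility of Gaussian binomials as polynomials and at integers. -/

section Divisibility

open Polynomial

/-- A monic polynomial whose values divide those of `B` at infinitely many integers divides `B`, so
the exceptional integers are bounded. -/
theorem Polynomial.Monic.exists_forall_not_eval_dvd {A B : ℤ[X]} (hA : A.Monic)
    (hAB : ¬ A ∣ B) : ∃ c : ℕ, ∀ q : ℕ, c ≤ q → ¬ A.eval (q : ℤ) ∣ B.eval (q : ℤ) := by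
  have hfin : {a : ℤ | A.eval a ∣ B.eval a}.Finite := by
    by_contra h
    exact hAB (dvd_of_infinite_eval_dvd_eval hA h)
  obtain ⟨b, hb⟩ := hfin.bddAbove
  refine ⟨b.toNat + 1, fun q hq hdvd => ?_⟩
  have := hb hdvd
  omega

theorem IsPrimitiveRoot.count_roots_X_pow_sub_one {ζ : ℂ} {d : ℕ} (hζ : IsPrimitiveRoot ζ d)
    {i : ℕ} (hi : 0 < i) :
    (X ^ i - 1 : ℂ[X]).roots.count ζ = if d ∣ i then 1 else 0 := by
  have hne : (X ^ i - 1 : ℂ[X]) ≠ 0 := X_pow_sub_C_ne_zero hi 1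
  have hnodup : (X ^ i - 1 : ℂ[X]).roots.Nodup :=
    nodup_roots (X_pow_sub_one_separable_iff.mpr (by exact_mod_cast hi.ne'))
  rw [Multiset.count_eq_of_nodup hnodup]
  congr 1
  rw [mem_roots hne, IsRoot.def, eval_sub, eval_pow, eval_X, eval_one, sub_eq_zero,
    hζ.pow_eq_one_iff_dvd]

theorem IsPrimitiveRoot.count_roots_prod_X_pow_sub_one {ζ : ℂ} {d : ℕ}
    (hζ : IsPrimitiveRoot ζ d) {s : Finset ℕ} (hs : ∀ i ∈ s, 0 < i) :
    (∏ i ∈ s, (X ^ i - 1 : ℂ[X])).roots.count ζ = (s.filter (d ∣ ·)).card := by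
  have hne : ∏ i ∈ s, (X ^ i - 1 : ℂ[X]) ≠ 0 :=
    Finset.prod_ne_zero_iff.mpr fun i hi => X_pow_sub_C_ne_zero (hs i hi) 1
  rw [roots_prod _ _ hne, Multiset.count_bind, Finset.card_filter]
  exact Finset.sum_congr rfl fun i hi => hζ.count_roots_X_pow_sub_one (hs i hi)

/-- The Gaussian binomial coefficient `[n, m - 1]` is not divisible by `[m]` as a polynomial if
`m` and `n - m + 1` are not coprime; stated after clearing denominators. -/
theorem not_prod_X_pow_sub_one_dvd {n m : ℕ} (hmn : m ≤ n) (hm : 0 < m)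
    (hgcd : 1 < Nat.gcd m (n - m + 1)) :
    ¬ (∏ i ∈ Finset.Ioc 0 m, (X ^ i - 1 : ℤ[X])) ∣
      (X - 1) * ∏ i ∈ Finset.Ioc (n - m + 1) n, (X ^ i - 1) := by
  intro hdvd
  set d := Nat.gcd m (n - m + 1) with hd
  obtain ⟨a, ha⟩ : d ∣ m := Nat.gcd_dvd_left _ _
  obtain ⟨b, hb⟩ : d ∣ n - m + 1 := Nat.gcd_dvd_right _ _
  have hζ := Complex.isPrimitiveRoot_exp d (by omega)
  set ζ := Complex.exp (2 * Real.pi * Complex.I / d)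
  have hdvd' := Polynomial.map_dvd (Int.castRingHom ℂ) hdvd
  simp only [Polynomial.map_mul, Polynomial.map_prod, Polynomial.map_sub, Polynomial.map_pow,
    Polynomial.map_X, Polynomial.map_one] at hdvd'
  have hB : ∏ i ∈ Finset.Ioc (n - m + 1) n, (X ^ i - 1 : ℂ[X]) ≠ 0 :=
    Finset.prod_ne_zero_iff.mpr fun i hi =>
      X_pow_sub_C_ne_zero (by have := (Finset.mem_Ioc.mp hi).1; omega) 1
  have hne : (X - 1 : ℂ[X]) * ∏ i ∈ Finset.Ioc (n - m + 1) n, (X ^ i - 1 : ℂ[X]) ≠ 0 :=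
    mul_ne_zero (X_sub_C_ne_zero 1) hB
  have hcount := Multiset.le_iff_count.mp (roots.le_of_dvd hne hdvd') ζ
  have h1 := hζ.count_roots_X_pow_sub_one one_pos
  rw [pow_one, if_neg (by rw [Nat.dvd_one]; omega)] at h1
  rw [roots_mul hne, Multiset.count_add, h1, zero_add,
    hζ.count_roots_prod_X_pow_sub_one (fun i hi => (Finset.mem_Ioc.mp hi).1),
    hζ.count_roots_prod_X_pow_sub_one (fun i hi => by have := (Finset.mem_Ioc.mp hi).1; omega),
    Nat.Ioc_filter_dvd_card_eq_div, ha, Nat.mul_div_cancel_left _ (by omega)] at hcount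
  -- Since `n - m + 1 = d * b` and `n = d * (a + b) - 1`, both endpoint multiples of `d` are missed.
  -- At most `a - 1` factors on the right vanish at `ζ`, against `a` on the left.
  have hsub : (Finset.Ioc (n - m + 1) n).filter (d ∣ ·) ⊆
      (Finset.Ioo b (a + b)).image (d * ·) := by
    intro i hi
    obtain ⟨hi, j, rfl⟩ := Finset.mem_filter.mp hi
    rw [Finset.mem_Ioc] at hi
    refine Finset.mem_image.mpr ⟨j, Finset.mem_Ioo.mpr ⟨?_, ?_⟩, rfl⟩
    · exact lt_of_mul_lt_mul_left (hb ▸ hi.1) (Nat.zero_le d)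
    · refine lt_of_mul_lt_mul_left (a := d) ?_ (Nat.zero_le d)
      rw [mul_add, ← ha, ← hb]
      omega
  have h2 := (Finset.card_le_card hsub).trans Finset.card_image_le
  rw [Nat.card_Ioo] at h2
  have ha0 : a ≠ 0 := by rintro rfl; omega
  rw [← ha] at hcount
  omega

end Divisibility

open Module

/-! ### Transitivity of the linear group on pairs of subspaces. -/

section LinearAlgebra

variable {F V V' : Type*} [Field F] [AddCommGroup V] [Module F V] [AddCommGroup V'] [Module F V']

/-- Linear equivalences between complementary summands glue. -/
theorem Submodule.exists_linearEquiv_of_isCompl {P Q : Submodule F V} {P' Q' : Submodule F V'}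
    (h : IsCompl P Q) (h' : IsCompl P' Q') (e : P ≃ₗ[F] P') (f : Q ≃ₗ[F] Q') :
    ∃ g : V ≃ₗ[F] V', (∀ x : P, g x = e x) ∧ ∀ x : Q, g x = f x := by
  refine ⟨(Submodule.prodEquivOfIsCompl P Q h).symm ≪≫ₗ
    LinearEquiv.prodCongr e f ≪≫ₗ Submodule.prodEquivOfIsCompl P' Q' h', fun x => ?_, fun x => ?_⟩
  · simp
  · simp

theorem Submodule.exists_linearEquiv_mapsTo [FiniteDimensional F V] [FiniteDimensional F V']
    (hV : finrank F V = finrank F V') {K : Submodule F V} {K' : Submodule F V'}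
    (hK : finrank F K = finrank F K') : ∃ g : V ≃ₗ[F] V', ∀ x ∈ K, g x ∈ K' := by
  obtain ⟨Q, hQ⟩ := K.exists_isCompl
  obtain ⟨Q', hQ'⟩ := K'.exists_isCompl
  have h1 := Submodule.finrank_add_eq_of_isCompl hQ
  have h2 := Submodule.finrank_add_eq_of_isCompl hQ'
  obtain ⟨g, hg, -⟩ := Submodule.exists_linearEquiv_of_isCompl hQ hQ'
    (LinearEquiv.ofFinrankEq _ _ hK) (LinearEquiv.ofFinrankEq Q Q' (by omega))
  exact ⟨g, fun x hx => by rw [hg ⟨x, hx⟩]; exact Subtype.prop _⟩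

/-- The general linear group is transitive on the pairs of subspaces of given dimensions whose
intersection has a given dimension. -/
theorem Submodule.exists_linearEquiv_map_eq_map_eq [FiniteDimensional F V]
    {X Y X' Y' : Submodule F V} (hX : finrank F X = finrank F X') (hY : finrank F Y = finrank F Y')
    (hXY : finrank F (X ⊓ Y : Submodule F V) = finrank F (X' ⊓ Y' : Submodule F V)) :
    ∃ g : V ≃ₗ[F] V, X.map (g : V →ₗ[F] V) = X' ∧ Y.map (g : V →ₗ[F] V) = Y' := by
  -- `B` is a complement of `X ⊓ Y` in `Y`. It is disjoint from `X`, so it extends to a complement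
  -- `Q` of `X`; the map can then be chosen independently on `X` and `Q`.
  have hdecomp : ∀ X Y : Submodule F V, ∃ B Q : Submodule F V, X ⊓ Y ⊔ B = Y ∧ B ≤ Q ∧
      IsCompl X Q ∧ finrank F (X ⊓ Y : Submodule F V) + finrank F B = finrank F Y := by
    intro X Y
    obtain ⟨E, hE⟩ := (X ⊓ Y).exists_isCompl
    have hsup : X ⊓ Y ⊔ E ⊓ Y = Y := by
      rw [← sup_inf_assoc_of_le E (inf_le_right : X ⊓ Y ≤ Y), hE.sup_eq_top, top_inf_eq]
    have hdisj : Disjoint X (E ⊓ Y) := by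
      rw [disjoint_iff, ← hE.inf_eq_bot, inf_comm E Y, inf_assoc]
    obtain ⟨Q, hBQ, hQ⟩ := hdisj.symm.exists_isCompl
    refine ⟨E ⊓ Y, Q, hsup, hBQ, hQ.symm, ?_⟩
    have h := Submodule.finrank_sup_add_finrank_inf_eq (X ⊓ Y) (E ⊓ Y)
    have h0 : X ⊓ Y ⊓ (E ⊓ Y) = ⊥ := (hdisj.mono_left inf_le_left).eq_bot
    rw [hsup, h0, finrank_bot] at h
    omega
  obtain ⟨B, Q, hB, hBQ, hQ, hBf⟩ := hdecomp X Y
  obtain ⟨B', Q', hB', hBQ', hQ', hBf'⟩ := hdecomp X' Y'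
  have hQf := Submodule.finrank_add_eq_of_isCompl hQ
  have hQf' := Submodule.finrank_add_eq_of_isCompl hQ'
  have hcomap : ∀ S T : Submodule F V, finrank F (T.comap S.subtype) =
      finrank F (S ⊓ T : Submodule F V) := fun S T => by
    rw [← Submodule.map_comap_subtype, ← finrank_map_subtype_eq]
  obtain ⟨e, he⟩ := Submodule.exists_linearEquiv_mapsTo hX
    (K := Y.comap X.subtype) (K' := Y'.comap X'.subtype) (by rw [hcomap, hcomap, hXY])
  obtain ⟨f, hf⟩ := Submodule.exists_linearEquiv_mapsTo (V := Q) (V' := Q') (by omega)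
    (K := B.comap Q.subtype) (K' := B'.comap Q'.subtype) (by
      rw [hcomap, hcomap, inf_eq_right.mpr hBQ, inf_eq_right.mpr hBQ']; omega)
  obtain ⟨g, hge, hgf⟩ := Submodule.exists_linearEquiv_of_isCompl hQ hQ' e f
  refine ⟨g, ?_, ?_⟩
  · refine Submodule.eq_of_le_of_finrank_eq ?_ (by rw [LinearEquiv.finrank_map_eq, hX])
    rintro _ ⟨x, hx, rfl⟩
    exact (hge ⟨x, hx⟩).symm ▸ Subtype.prop _
  · refine Submodule.eq_of_le_of_finrank_eq ?_ (by rw [LinearEquiv.finrank_map_eq, hY])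
    rw [← hB, Submodule.map_sup, sup_le_iff]
    constructor
    · rintro _ ⟨x, hx, rfl⟩
      exact (hge ⟨x, hx.1⟩).symm ▸ he ⟨x, hx.1⟩ hx.2
    · rintro _ ⟨x, hx, rfl⟩
      have h := hf ⟨x, hBQ hx⟩ hx
      exact (hgf ⟨x, hBQ hx⟩).symm ▸ (hB' ▸ le_sup_right : B' ≤ Y') h

theorem Submodule.exists_le_le_finrank_eq [FiniteDimensional F V] {K X : Submodule F V}
    (hKX : K ≤ X) {k : ℕ} (h1 : finrank F K ≤ k) (h2 : k ≤ finrank F X) :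
    ∃ H, K ≤ H ∧ H ≤ X ∧ finrank F H = k := by
  induction k, h1 using Nat.le_induction with
  | base => exact ⟨K, le_rfl, hKX, rfl⟩
  | succ k _ ih =>
    obtain ⟨H, hKH, hHX, hH⟩ := ih (by omega)
    obtain ⟨x, hx, hxH⟩ := SetLike.not_le_iff_exists.mp fun h : X ≤ H => by
      have := Submodule.finrank_mono h
      omega
    refine ⟨H ⊔ F ∙ x, hKH.trans le_sup_left,
      sup_le hHX ((Submodule.span_singleton_le_iff_mem _ _).mpr hx), ?_⟩
    have hle := Submodule.finrank_add_le_finrank_add_finrank H (F ∙ x)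
    have hx0 : x ≠ 0 := fun h => hxH (h ▸ H.zero_mem)
    rw [finrank_span_singleton hx0] at hle
    have hlt : H < H ⊔ F ∙ x := lt_of_le_of_ne le_sup_left fun h =>
      hxH (h ▸ (le_sup_right : F ∙ x ≤ H ⊔ F ∙ x) (Submodule.mem_span_singleton_self x))
    have := Submodule.finrank_lt_finrank_of_lt hlt
    omega

end LinearAlgebra

/-! ### Symmetry and connectedness of the Grassmann graph. -/

section Grassmann

variable {F V : Type*} [Field F] [AddCommGroup V] [Module F V] [FiniteDimensional F V] {m : ℕ}

/-- The automorphism of the Grassmann graph induced by a linear automorphism. -/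
def grassmannGraphIso (g : V ≃ₗ[F] V) : grassmannGraph F V m ≃g grassmannGraph F V m where
  toEquiv := (Submodule.orderIsoMapComap g).toEquiv.subtypeEquiv fun X => by
    change _ ↔ finrank F (X.map (g : V →ₗ[F] V)) = m
    rw [LinearEquiv.finrank_map_eq]
  map_rel_iff' := by
    intro X Y
    change finrank F (X.1.map (g : V →ₗ[F] V) ⊓ Y.1.map (g : V →ₗ[F] V) : Submodule F V) + 1 = m ↔
      finrank F (X.1 ⊓ Y.1 : Submodule F V) + 1 = m
    rw [← Submodule.map_inf _ g.injective, LinearEquiv.finrank_map_eq]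

theorem exists_grassmannGraph_iso {X Y X' Y' : {X : Submodule F V // finrank F X = m}}
    (h : finrank F (X.1 ⊓ Y.1 : Submodule F V) = finrank F (X'.1 ⊓ Y'.1 : Submodule F V)) :
    ∃ ψ : grassmannGraph F V m ≃g grassmannGraph F V m, ψ X = X' ∧ ψ Y = Y' := by
  obtain ⟨g, hX, hY⟩ := Submodule.exists_linearEquiv_map_eq_map_eq (X.2.trans X'.2.symm)
    (Y.2.trans Y'.2.symm) h
  exact ⟨grassmannGraphIso g, Subtype.ext hX, Subtype.ext hY⟩

theorem grassmannGraph_ncard_neighborSet (X Y : {X : Submodule F V // finrank F X = m}) :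
    ((grassmannGraph F V m).neighborSet X).ncard =
      ((grassmannGraph F V m).neighborSet Y).ncard := by
  obtain ⟨ψ, hψ, -⟩ := exists_grassmannGraph_iso (X := X) (Y := X) (X' := Y) (Y' := Y)
    (by rw [inf_idem, inf_idem, X.2, Y.2])
  rw [← Nat.card_coe_set_eq, ← Nat.card_coe_set_eq, ← hψ]
  exact Nat.card_congr (ψ.mapNeighborSet X)

theorem finrank_inf_lt {X Y : {X : Submodule F V // finrank F X = m}} (h : X ≠ Y) :
    finrank F (X.1 ⊓ Y.1 : Submodule F V) < m := by
  refine lt_of_le_of_ne ((Submodule.finrank_mono inf_le_left).trans_eq X.2) fun heq => h (Subtype.ext ?_)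
  have h1 : X.1 ⊓ Y.1 = X.1 :=
    Submodule.eq_of_le_of_finrank_eq inf_le_left (heq.trans X.2.symm)
  have h2 : X.1 ⊓ Y.1 = Y.1 :=
    Submodule.eq_of_le_of_finrank_eq inf_le_right (heq.trans Y.2.symm)
  exact h1.symm.trans h2

/-- Two hyperplanes of `Y` meet in codimension at most two. Hence the pairs at distance two form a
single orbit. -/
theorem finrank_inf_add_two_of_adj_of_adj {X Y Z : {X : Submodule F V // finrank F X = m}}
    (hXY : (grassmannGraph F V m).Adj X Y) (hYZ : (grassmannGraph F V m).Adj Y Z) (hne : X ≠ Z)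
    (hXZ : ¬ (grassmannGraph F V m).Adj X Z) :
    finrank F (X.1 ⊓ Z.1 : Submodule F V) + 2 = m := by
  have hlt := finrank_inf_lt hne
  have h := Submodule.finrank_sup_add_finrank_inf_eq (X.1 ⊓ Y.1) (Y.1 ⊓ Z.1)
  have h1 : finrank F (X.1 ⊓ Y.1 ⊔ Y.1 ⊓ Z.1 : Submodule F V) ≤ m :=
    (Submodule.finrank_mono (sup_le inf_le_right inf_le_left)).trans_eq Y.2
  have h2 : finrank F (X.1 ⊓ Y.1 ⊓ (Y.1 ⊓ Z.1) : Submodule F V) ≤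
      finrank F (X.1 ⊓ Z.1 : Submodule F V) :=
    Submodule.finrank_mono (inf_le_inf inf_le_left inf_le_right)
  change _ + 1 = m at hXY hYZ
  change ¬ _ + 1 = m at hXZ
  omega

theorem grassmannGraph_preconnected : (grassmannGraph F V m).Preconnected := by
  suffices ∀ k, ∀ X Y : {X : Submodule F V // finrank F X = m},
      m ≤ finrank F (X.1 ⊓ Y.1 : Submodule F V) + k → (grassmannGraph F V m).Reachable X Y by
    intro X Y
    refine this (m - finrank F (X.1 ⊓ Y.1 : Submodule F V)) X Y ?_
    omega
  intro k
  induction k with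
  | zero =>
    intro X Y h
    by_cases hXY : X = Y
    · exact hXY ▸ SimpleGraph.Reachable.refl _
    · have := finrank_inf_lt hXY
      omega
  | succ k ih =>
    intro X Y h
    by_cases hne : X = Y
    · exact hne ▸ SimpleGraph.Reachable.refl _
    have hlt := finrank_inf_lt hne
    -- Exchange one dimension: a hyperplane `H` of `X` and a `K ≤ Y` one dimension above `X ⊓ Y`
    -- span a neighbour of `X` that meets `Y` in a larger subspace.
    obtain ⟨H, hH1, hHX, hH⟩ := Submodule.exists_le_le_finrank_eq
      (inf_le_left : X.1 ⊓ Y.1 ≤ X.1) (k := m - 1) (by omega) (by rw [X.2]; omega)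
    have hHY : H ⊓ Y.1 = X.1 ⊓ Y.1 :=
      le_antisymm (inf_le_inf_right _ hHX) (le_inf hH1 inf_le_right)
    obtain ⟨K, hK1, hKY, hK⟩ := Submodule.exists_le_le_finrank_eq
      (inf_le_right : X.1 ⊓ Y.1 ≤ Y.1) (k := finrank F (X.1 ⊓ Y.1 : Submodule F V) + 1)
      (by omega) (by rw [Y.2]; omega)
    have hHK : H ⊓ K = X.1 ⊓ Y.1 :=
      le_antisymm (hHY ▸ inf_le_inf_left _ hKY) (le_inf hH1 hK1)
    have hsum := Submodule.finrank_sup_add_finrank_inf_eq H K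
    rw [hHK] at hsum
    let Z : {X : Submodule F V // finrank F X = m} := ⟨H ⊔ K, by omega⟩
    have hXK : X.1 ⊓ K = X.1 ⊓ Y.1 :=
      le_antisymm (inf_le_inf_left _ hKY) (le_inf inf_le_left hK1)
    have hXZ : X.1 ⊓ Z.1 = H := by
      change X.1 ⊓ (H ⊔ K) = H
      rw [inf_comm, sup_inf_assoc_of_le K hHX, inf_comm K, hXK, sup_eq_left]
      exact hH1
    have hYZ : K ≤ Z.1 ⊓ Y.1 := le_inf le_sup_right hKY
    have hadj : (grassmannGraph F V m).Adj X Z := by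
      change finrank F (X.1 ⊓ Z.1 : Submodule F V) + 1 = m
      rw [hXZ]
      omega
    have hle := Submodule.finrank_mono hYZ
    refine hadj.reachable.trans (ih Z Y ?_)
    omega

end Grassmann

/-! ### Counting subspaces over a finite field. -/

section Counting

/-- Double counting of a relation that is biregular. -/
theorem Nat.card_mul_eq_card_mul {α β : Type*} [Finite α] [Finite β] (r : α → β → Prop) {k l : ℕ}
    (hk : ∀ a, {b | r a b}.ncard = k) (hl : ∀ b, {a | r a b}.ncard = l) :
    Nat.card α * k = Nat.card β * l := by
  classical
  have := Fintype.ofFinite α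
  have := Fintype.ofFinite β
  rw [Nat.card_eq_fintype_card, Nat.card_eq_fintype_card]
  refine Finset.card_mul_eq_card_mul r (fun a _ => ?_) fun b _ => ?_
  · rw [← hk a, ← Set.ncard_coe_finset]
    simp
  · rw [← hl b, ← Set.ncard_coe_finset]
    simp

theorem Submodule.finrank_map_mkQ_add {F V : Type*} [Field F] [AddCommGroup V] [Module F V]
    [FiniteDimensional F V] {W Z : Submodule F V} (h : W ≤ Z) :
    finrank F (Z.map W.mkQ) + finrank F W = finrank F Z := by
  have := LinearMap.finrank_range_add_finrank_ker (W.mkQ.domRestrict Z)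
  rwa [LinearMap.range_domRestrict, LinearMap.ker_domRestrict, Submodule.ker_mkQ,
    finrank_map_subtype_eq Z (W.comap Z.subtype) |>.symm, Submodule.map_comap_subtype,
    inf_eq_right.mpr h] at this

variable {F V : Type*} [Field F] [Finite F] [AddCommGroup V] [Module F V] [FiniteDimensional F V]

open LinearAlgebra.Projectivization in
theorem Projectivization.natCard_mul (F V : Type*) [Field F] [Finite F] [AddCommGroup V]
    [Module F V] [FiniteDimensional F V] :
    (Nat.card (ℙ F V) : ℤ) * ((Nat.card F : ℤ) - 1) = (Nat.card F : ℤ) ^ finrank F V - 1 := by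
  have := Module.finite_of_finite F (M := V)
  have h := Projectivization.card' F V
  rw [Module.natCard_eq_pow_finrank (K := F)] at h
  have hF : 1 ≤ Nat.card F := Nat.card_pos
  zify [hF] at h
  linarith

/-- The number of `k + 1`-dimensional subspaces containing a `k`-dimensional one. -/
theorem ncard_superspaces {k j : ℕ} (W : Submodule F V) (hW : finrank F W = k)
    (hV : finrank F V = k + j) :
    ({Z : {X : Submodule F V // finrank F X = k + 1} | W ≤ Z.1}.ncard : ℤ) *
      ((Nat.card F : ℤ) - 1) = (Nat.card F : ℤ) ^ j - 1 := by
  have hcard : {Z : {X : Submodule F V // finrank F X = k + 1} | W ≤ Z.1}.ncard =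
      Nat.card {L : Submodule F (V ⧸ W) // finrank F L = 1} := by
    rw [← Nat.card_coe_set_eq]
    refine Nat.card_congr ⟨fun Z => ⟨Z.1.1.map W.mkQ, ?_⟩,
      fun L => ⟨⟨L.1.comap W.mkQ, ?_⟩, W.le_comap_mkQ L.1⟩, fun Z => ?_, fun L => ?_⟩
    · have h1 := Submodule.finrank_map_mkQ_add Z.2
      have h2 := Z.1.2
      omega
    · have h1 := Submodule.finrank_map_mkQ_add (W.le_comap_mkQ L.1)
      rw [Submodule.map_comap_eq_of_surjective W.mkQ_surjective, L.2, hW] at h1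
      omega
    · exact Subtype.ext (Subtype.ext (by
        have hZ : W ≤ Z.1.1 := Z.2
        simpa [Submodule.comap_map_mkQ] using hZ))
    · exact Subtype.ext (Submodule.map_comap_eq_of_surjective W.mkQ_surjective _)
  have hQ := Submodule.finrank_quotient_add_finrank W
  rw [hcard, ← Nat.card_congr (Projectivization.equivSubmodule F (V ⧸ W)),
    Projectivization.natCard_mul, show finrank F (V ⧸ W) = j by omega]

/-- By duality hyperplanes are the points of the dual projective space. -/
theorem natCard_hyperplanes {k : ℕ} (hV : finrank F V = k + 1) :
    (Nat.card {H : Submodule F V // finrank F H = k} : ℤ) *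
      ((Nat.card F : ℤ) - 1) = (Nat.card F : ℤ) ^ (k + 1) - 1 := by
  have e : {H : Submodule F V // finrank F H = k} ≃
      {L : Submodule F (Dual F V) // finrank F L = 1} :=
    (Subspace.orderIsoFiniteDimensional (K := F) (V := V)).toEquiv.subtypeEquiv fun H => by
      change _ ↔ finrank F H.dualAnnihilator = 1
      have := Subspace.finrank_add_finrank_dualAnnihilator_eq H
      omega
  rw [Nat.card_congr e, ← Nat.card_congr (Projectivization.equivSubmodule F (Dual F V)),
    Projectivization.natCard_mul, Subspace.dual_finrank_eq, hV]

/-- The number of `k`-dimensional subspaces of a `k + 1`-dimensional one. -/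
theorem ncard_subspaces {k : ℕ} (U : Submodule F V) (hU : finrank F U = k + 1) :
    ({Z : {X : Submodule F V // finrank F X = k} | Z.1 ≤ U}.ncard : ℤ) *
      ((Nat.card F : ℤ) - 1) = (Nat.card F : ℤ) ^ (k + 1) - 1 := by
  rw [← natCard_hyperplanes hU, ← Nat.card_coe_set_eq]
  congr 2
  refine Nat.card_congr ⟨fun Z => ⟨Z.1.1.comap U.subtype, ?_⟩,
    fun H => ⟨⟨H.1.map U.subtype, ?_⟩, Submodule.map_subtype_le _ _⟩, fun Z => ?_, fun H => ?_⟩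
  · rw [← Submodule.finrank_map_subtype_eq, Submodule.map_comap_subtype, inf_eq_right.mpr Z.2, Z.1.2]
  · rw [Submodule.finrank_map_subtype_eq, H.2]
  · exact Subtype.ext (Subtype.ext (by
      have hZ : Z.1.1 ≤ U := Z.2
      simpa [Submodule.map_comap_subtype] using hZ))
  · exact Subtype.ext (Submodule.comap_map_eq_of_injective U.injective_subtype _)

theorem one_lt_natCard_cast (F : Type*) [Field F] [Finite F] : (1 : ℤ) < Nat.card F := by
  exact_mod_cast Finite.one_lt_card

theorem ncard_eq_ncard_of_mul_eq {a b : ℕ} {c : ℤ}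
    (ha : (a : ℤ) * ((Nat.card F : ℤ) - 1) = c) (hb : (b : ℤ) * ((Nat.card F : ℤ) - 1) = c) :
    a = b := by
  have := one_lt_natCard_cast F
  exact_mod_cast mul_right_cancel₀ (by omega) (ha.trans hb.symm)

/-- Double counting of the inclusions between the two dimensions gives the recursion for Gaussian
binomials. -/
theorem natCard_subspaces_succ {k j : ℕ} (hV : finrank F V = k + j) :
    (Nat.card {X : Submodule F V // finrank F X = k + 1} : ℤ) *
      ((Nat.card F : ℤ) ^ (k + 1) - 1) =
    (Nat.card {X : Submodule F V // finrank F X = k} : ℤ) * ((Nat.card F : ℤ) ^ j - 1) := by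
  have := Module.finite_of_finite F (M := V)
  obtain hemp | ⟨⟨W⟩⟩ := isEmpty_or_nonempty {X : Submodule F V // finrank F X = k}
  -- The valencies are read off a sample subspace of each dimension, so the cases without one are
  -- treated apart.
  · have : IsEmpty {X : Submodule F V // finrank F X = k + 1} := ⟨fun X => by
      obtain ⟨H, -, -, hH⟩ := Submodule.exists_le_le_finrank_eq (bot_le : ⊥ ≤ X.1) (k := k)
        (by simp) (by rw [X.2]; omega)
      exact hemp.elim ⟨H, hH⟩⟩
    simp
  obtain hemp | ⟨⟨U⟩⟩ := isEmpty_or_nonempty {X : Submodule F V // finrank F X = k + 1}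
  · have hj : j = 0 := by
      by_contra hj
      obtain ⟨H, -, -, hH⟩ := Submodule.exists_le_le_finrank_eq (bot_le : ⊥ ≤ (⊤ : Submodule F V))
        (k := k + 1) (by simp) (by rw [finrank_top]; omega)
      exact hemp.elim ⟨H, hH⟩
    simp [hj]
  have h := Nat.card_mul_eq_card_mul
    (fun (X : {X : Submodule F V // finrank F X = k + 1})
      (Y : {X : Submodule F V // finrank F X = k}) => Y.1 ≤ X.1)
    (fun X => ncard_eq_ncard_of_mul_eq (ncard_subspaces X.1 X.2) (ncard_subspaces U.1 U.2))
    (fun Y => ncard_eq_ncard_of_mul_eq (ncard_superspaces Y.1 Y.2 hV)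
      (ncard_superspaces W.1 W.2 hV))
  rw [← ncard_subspaces U.1 U.2, ← ncard_superspaces W.1 W.2 hV, ← mul_assoc, ← mul_assoc]
  exact congrArg (· * _) (by exact_mod_cast h)

/-- The Gaussian binomial coefficient counting the `k`-dimensional subspaces. -/
theorem natCard_subspaces_mul_prod {n k : ℕ} (hV : finrank F V = n) (hk : k ≤ n) :
    (Nat.card {X : Submodule F V // finrank F X = k} : ℤ) *
      ∏ i ∈ Finset.Ioc 0 k, ((Nat.card F : ℤ) ^ i - 1) =
    ∏ i ∈ Finset.Ioc (n - k) n, ((Nat.card F : ℤ) ^ i - 1) := by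
  induction k with
  | zero => simp [Submodule.finrank_eq_zero]
  | succ k ih =>
    have h := natCard_subspaces_succ (F := F) (V := V) (k := k) (j := n - k) (by omega)
    have hI : Finset.Ioc (n - (k + 1)) n = insert (n - k) (Finset.Ioc (n - k) n) := by
      ext i
      simp only [Finset.mem_Ioc, Finset.mem_insert]
      omega
    rw [hI, Finset.prod_insert (by simp), ← ih (by omega)]
    rw [Finset.prod_Ioc_succ_top (Nat.zero_le k)]
    linear_combination (∏ i ∈ Finset.Ioc 0 k, ((Nat.card F : ℤ) ^ i - 1)) * h

end Counting

/-! ### Maximum cliques and the Steiner system in a fibre. -/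

section Cliques

variable {F V : Type*} [Field F] [AddCommGroup V] [Module F V] [FiniteDimensional F V] {m : ℕ}

theorem grassmannGraph_adj_of_le {W : Submodule F V} (hW : finrank F W + 1 = m)
    {X Y : {X : Submodule F V // finrank F X = m}} (hX : W ≤ X.1) (hY : W ≤ Y.1) (hne : X ≠ Y) :
    (grassmannGraph F V m).Adj X Y := by
  have h1 := Submodule.finrank_mono (le_inf hX hY)
  have h2 := finrank_inf_lt hne
  change _ + 1 = m
  omega

/-- A clique of the Grassmann graph consists of subspaces through a common `m - 1`-dimensional
subspace or of subspaces of a common `m + 1`-dimensional one. -/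
theorem grassmannGraph_isClique_cases {C : Set {X : Submodule F V // finrank F X = m}}
    (hC : (grassmannGraph F V m).IsClique C) (hnt : C.Nontrivial) :
    (∃ W : Submodule F V, finrank F W + 1 = m ∧ ∀ X ∈ C, W ≤ X.1) ∨
      ∃ U : Submodule F V, finrank F U = m + 1 ∧ ∀ X ∈ C, X.1 ≤ U := by
  obtain ⟨X, hX, Y, hY, hXY⟩ := hnt
  have hW : finrank F (X.1 ⊓ Y.1 : Submodule F V) + 1 = m := hC hX hY hXY
  have hU : finrank F (X.1 ⊔ Y.1 : Submodule F V) = m + 1 := by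
    have := Submodule.finrank_sup_add_finrank_inf_eq X.1 Y.1
    have := X.2
    have := Y.2
    omega
  have key : ∀ Z ∈ C, X.1 ⊓ Y.1 ≤ Z.1 ∨ Z.1 ≤ X.1 ⊔ Y.1 := by
    intro Z hZ
    by_cases hZX : Z = X
    · exact Or.inl (hZX ▸ inf_le_left)
    by_cases hZY : Z = Y
    · exact Or.inl (hZY ▸ inf_le_right)
    have hA : finrank F (Z.1 ⊓ X.1 : Submodule F V) + 1 = m := hC hZ hX hZX
    have hB : finrank F (Z.1 ⊓ Y.1 : Submodule F V) + 1 = m := hC hZ hY hZY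
    by_cases hAY : Z.1 ⊓ X.1 ≤ Y.1
    · left
      rw [← Submodule.eq_of_le_of_finrank_eq (le_inf inf_le_right hAY : Z.1 ⊓ X.1 ≤ X.1 ⊓ Y.1)
        (by omega)]
      exact inf_le_left
    · right
      have hlt : Z.1 ⊓ Y.1 < Z.1 ⊓ X.1 ⊔ Z.1 ⊓ Y.1 := by
        refine lt_of_le_of_ne le_sup_right fun h => hAY ?_
        exact (le_sup_left.trans h.ge).trans inf_le_right
      have hfin := Submodule.finrank_lt_finrank_of_lt hlt
      have hZ2 := Z.2
      rw [← Submodule.eq_of_le_of_finrank_le (sup_le inf_le_left inf_le_left :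
        Z.1 ⊓ X.1 ⊔ Z.1 ⊓ Y.1 ≤ Z.1) (by omega)]
      exact sup_le_sup inf_le_right inf_le_right
  -- If `Z` refutes the first type and `T` the second, then `Z ≤ X ⊔ Y` and `T` meets `X ⊔ Y` only
  -- in `X ⊓ Y`. So `Z ⊓ T`, of dimension `m - 1`, is `X ⊓ Y`, and `Z` contains it after all.
  by_contra! hcon
  obtain ⟨Z, hZ, hWZ⟩ := hcon.1 _ hW
  obtain ⟨T, hT, hTU⟩ := hcon.2 _ hU
  have hZU := (key Z hZ).resolve_left hWZ
  have hWT := (key T hT).resolve_right hTU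
  have hZT : finrank F (Z.1 ⊓ T.1 : Submodule F V) + 1 = m :=
    hC hZ hT fun h => hWZ (h ▸ hWT)
  have hlt : (X.1 ⊔ Y.1) ⊓ T.1 < T.1 := lt_of_le_of_ne inf_le_right fun h => hTU (inf_eq_right.mp h)
  have hfin := Submodule.finrank_lt_finrank_of_lt hlt
  have hT2 := T.2
  have h1 : X.1 ⊓ Y.1 = (X.1 ⊔ Y.1) ⊓ T.1 :=
    Submodule.eq_of_le_of_finrank_le (le_inf (inf_le_left.trans le_sup_left) hWT) (by omega)
  have h2 : Z.1 ⊓ T.1 = X.1 ⊓ Y.1 :=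
    Submodule.eq_of_le_of_finrank_eq (h1 ▸ inf_le_inf_right _ hZU) (by omega)
  exact hWZ (h2 ▸ inf_le_left)

/-- No clique is larger than the set of `m`-dimensional subspaces through an `m - 1`-dimensional
one. -/
theorem grassmannGraph_isClique_ncard_mul_le [Finite F] {n : ℕ} (hV : finrank F V = n)
    (hmn : 2 * m ≤ n) {C : Set {X : Submodule F V // finrank F X = m}}
    (hC : (grassmannGraph F V m).IsClique C) :
    (C.ncard : ℤ) * ((Nat.card F : ℤ) - 1) ≤ (Nat.card F : ℤ) ^ (n - m + 1) - 1 := by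
  have := Module.finite_of_finite F (M := V)
  have hq := one_lt_natCard_cast F
  obtain hs | hnt := C.subsingleton_or_nontrivial
  · have h1 : (C.ncard : ℤ) ≤ 1 := by exact_mod_cast Set.ncard_le_one_iff_subsingleton.mpr hs
    have h2 : (Nat.card F : ℤ) ^ 1 ≤ (Nat.card F : ℤ) ^ (n - m + 1) :=
      pow_le_pow_right₀ hq.le (by omega)
    nlinarith
  obtain ⟨W, hW, hWC⟩ | ⟨U, hU, hUC⟩ := grassmannGraph_isClique_cases hC hnt
  · subst hW
    rw [← ncard_superspaces W rfl (j := n - (finrank F W + 1) + 1) (by omega)]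
    exact mul_le_mul_of_nonneg_right (by exact_mod_cast Set.ncard_le_ncard hWC (Set.toFinite _))
      (by omega)
  -- By `2 * m ≤ n`, cliques of the second type do not exceed a star.
  · have h2 : (Nat.card F : ℤ) ^ (m + 1) ≤ (Nat.card F : ℤ) ^ (n - m + 1) :=
      pow_le_pow_right₀ hq.le (by omega)
    refine le_trans ?_ (sub_le_sub_right h2 1)
    rw [← ncard_subspaces U hU]
    exact mul_le_mul_of_nonneg_right (by exact_mod_cast Set.ncard_le_ncard hUC (Set.toFinite _))
      (by omega)

/-- If the Grassmann graph maps onto one of its cliques, then `[m]` divides the number of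
`m - 1`-dimensional subspaces. -/
theorem exists_mul_eq_natCard_mul_of_range_isClique [Finite F] {n k : ℕ} (hV : finrank F V = n)
    (hkn : 2 * (k + 1) ≤ n) (g : grassmannGraph F V (k + 1) →g grassmannGraph F V (k + 1))
    (hg : (grassmannGraph F V (k + 1)).IsClique (Set.range g)) :
    ∃ t : ℕ, (t : ℤ) * ((Nat.card F : ℤ) ^ (k + 1) - 1) =
      (Nat.card {X : Submodule F V // finrank F X = k} : ℤ) * ((Nat.card F : ℤ) - 1) := by
  have := Module.finite_of_finite F (M := V)
  have hq := one_lt_natCard_cast F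
  obtain ⟨X₀, -, -, hX₀⟩ := Submodule.exists_le_le_finrank_eq
    (bot_le : ⊥ ≤ (⊤ : Submodule F V)) (k := k + 1) (by simp) (by rw [finrank_top]; omega)
  let A : {X : Submodule F V // finrank F X = k + 1} := ⟨X₀, hX₀⟩
  -- A star is a clique, so `g` is injective on it; being of maximum size, it fills the whole range
  -- and meets the fibre over `g A` once.
  have hstar : ∀ W : {X : Submodule F V // finrank F X = k},
      {X : {X // g X = g A} | W.1 ≤ X.1.1}.ncard = 1 := by
    intro W
    have hinj : Set.InjOn g {X | W.1 ≤ X.1} := fun X hX Y hY hXY => by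
      by_contra hne
      exact (g.map_adj (grassmannGraph_adj_of_le (by rw [W.2]) hX hY hne)).ne hXY
    have himage : g '' {X | W.1 ≤ X.1} = Set.range g := by
      refine Set.eq_of_subset_of_ncard_le (Set.image_subset_range _ _) ?_ (Set.toFinite _)
      rw [hinj.ncard_image]
      have h1 := grassmannGraph_isClique_ncard_mul_le hV hkn hg
      rw [← ncard_superspaces W.1 W.2 (j := n - (k + 1) + 1) (by omega)] at h1
      exact_mod_cast le_of_mul_le_mul_right h1 (by omega)
    obtain ⟨X, hX, hXA⟩ : g A ∈ g '' {X | W.1 ≤ X.1} := himage ▸ Set.mem_range_self A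
    refine Set.ncard_eq_one.mpr ⟨⟨X, hXA⟩, Set.eq_singleton_iff_unique_mem.mpr ⟨hX, ?_⟩⟩
    exact fun Y hY => Subtype.ext (hinj hY hX (Y.2.trans hXA.symm))
  have h := Nat.card_mul_eq_card_mul
    (fun (X : {X // g X = g A}) (W : {X : Submodule F V // finrank F X = k}) => W.1 ≤ X.1.1)
    (fun X => ncard_eq_ncard_of_mul_eq (ncard_subspaces X.1.1 X.1.2) (ncard_subspaces A.1 A.2))
    hstar
  refine ⟨Nat.card {X // g X = g A}, ?_⟩
  rw [← ncard_subspaces A.1 A.2, ← mul_assoc]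
  exact congrArg (· * _) (by rw [mul_one] at h; exact_mod_cast h)

end Cliques

/-! ### The dichotomy for Grassmann graphs against the divisibility obstruction. -/

theorem grassmannGraph_isCore_or_exists_range_isClique {F V : Type*} [Field F] [Finite F]
    [AddCommGroup V] [Module F V] [FiniteDimensional F V] {m : ℕ} :
    (grassmannGraph F V m).IsCore ∨ ∃ g : grassmannGraph F V m →g grassmannGraph F V m,
      (grassmannGraph F V m).IsClique (Set.range g) := by
  have := Module.finite_of_finite F (M := V)
  refine SimpleGraph.isCore_or_exists_range_isClique grassmannGraph_preconnected
    grassmannGraph_ncard_neighborSet ?_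
  intro a b c a' b' c' hab hbc hac hnac hab' hbc' hac' hnac'
  have h := finrank_inf_add_two_of_adj_of_adj hab hbc hac hnac
  have h' := finrank_inf_add_two_of_adj_of_adj hab' hbc' hac' hnac'
  exact exists_grassmannGraph_iso (by omega)

theorem theorem4p4 (n m : ℕ) (hm : 4 ≤ 2 * m) (hmn : 2 * m ≤ n)
    (hgcd : 1 < Nat.gcd m (n - m + 1)) :
    ∃ c : ℕ, 0 < c ∧ ∀ q : ℕ, IsPrimePow q → c ≤ q →
      ∀ (F : Type*) [Field F] [Finite F], Nat.card F = q →
        (grassmannGraph F (Fin n → F) m).IsCore := by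
  have hmonic : (∏ i ∈ Finset.Ioc 0 m, (Polynomial.X ^ i - 1 : Polynomial ℤ)).Monic :=
    Polynomial.monic_prod_of_monic _ _ fun i hi =>
      Polynomial.monic_X_pow_sub_C 1 (Finset.mem_Ioc.mp hi).1.ne'
  obtain ⟨c, hc⟩ := hmonic.exists_forall_not_eval_dvd
    (not_prod_X_pow_sub_one_dvd (by omega) (by omega) hgcd)
  refine ⟨c + 1, c.succ_pos, fun q _ hcq F _ _ hF => ?_⟩
  refine grassmannGraph_isCore_or_exists_range_isClique.resolve_right ?_
  rintro ⟨g, hg⟩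
  obtain ⟨k, rfl⟩ : ∃ k, m = k + 1 := ⟨m - 1, by omega⟩
  have hV : finrank F (Fin n → F) = n := finrank_fin_fun F
  obtain ⟨t, ht⟩ := exists_mul_eq_natCard_mul_of_range_isClique hV hmn g hg
  have hcount := natCard_subspaces_mul_prod (F := F) hV (k := k) (by omega)
  rw [hF] at ht hcount
  -- The fibre size `t` is itself the quotient once the denominators of `[n, m-1]` are cleared.
  refine hc q (by omega) ⟨t, ?_⟩
  simp only [Polynomial.eval_mul, Polynomial.eval_prod, Polynomial.eval_sub, Polynomial.eval_pow,
    Polynomial.eval_X, Polynomial.eval_one]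
  rw [show n - (k + 1) + 1 = n - k by omega, ← hcount, Finset.prod_Ioc_succ_top (Nat.zero_le k)]
  linear_combination (-∏ i ∈ Finset.Ioc 0 k, ((q : ℤ) ^ i - 1)) * ht
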